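/- Let $a\in(0,1)$ and $p\in(0,1)$, and let $C(u,v)=a\,M(u,v)+(1-a)\,W(u,v)$ be the copula on $[0,1]^2$ with $M(u,v)=\min(u,v)$ and $W(u,v)=\max(u+v-1,0)$. For each $n\ge 0$ let $X=(X_t)_{t=0,\dots,n}$ be a stationary Markov chain generated by $C$ and the Bernoulli($p$) marginal distribution; that is, every $X_t$ satisfies $P(X_t=1)=p=1-P(X_t=0)$, the sequence has the Markov property, and for all $0\le t<n$ and all real $x,y$, $$P(X_t\le x,\ X_{t+1}\le y)=C(F(x),F(y)),$$ where $F$ is the distribution function of the Bernoulli($p$) law. Let $\bar p=\frac{1}{n+1}\sum_{t=0}^{n}X_t$ be the sample mean. Then, as $n\to\infty$, $$\sqrt{n+1}\,(\bar p-p)\ \xrightarrow{\ d\ }\ N(0,\sigma^2),\qquad \sigma^2=\begin{cases}\dfrac{p(1-p)(1+a-2p)}{1-a}, & p<1/2,\\[2mm] \dfrac{p(1-p)(a+2p-1)}{1-a}, & p\ge 1/2.\end{cases}$$ -/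

import Mathlib

open MeasureTheory ProbabilityTheory Filter

noncomputable section

/-- The Fréchet upper bound copula `M(u, v) = min(u, v)`. -/
def copulaM (u v : ℝ) : ℝ := min u v

/-- The Fréchet lower bound copula `W(u, v) = max(u + v - 1, 0)`. -/
def copulaW (u v : ℝ) : ℝ := max (u + v - 1) 0

/-- The copula `C(u, v) = a M(u, v) + (1 - a) W(u, v)` on the unit square. -/
def frechetCopula (a : ℝ) (u v : ℝ) : ℝ := a * copulaM u v + (1 - a) * copulaW u v

/-- `X 0, …, X n` is a Markov chain on `(Ω, P)` generated by the copula `C` and the marginal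
distribution `ν` on `ℝ`: every `X t` is a random variable with law `ν`, the joint distribution
function of every pair `(X t, X (t + 1))` is `(x, y) ↦ C (F x) (F y)` with `F` the distribution
function of `ν`, and the Markov property holds. The transitions and the marginal do not depend
on time, so such a chain is stationary. Only the variables with index at most `n` matter. -/
structure IsCopulaMarkovChain {Ω : Type*} [MeasurableSpace Ω] (P : Measure Ω)
    (C : ℝ → ℝ → ℝ) (ν : Measure ℝ) (n : ℕ) (X : ℕ → Ω → ℝ) : Prop where
  measurable : ∀ t ≤ n, Measurable (X t)
  hasLaw : ∀ t ≤ n, HasLaw (X t) ν P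
  joint : ∀ t < n, ∀ x y : ℝ,
    P.real {ω | X t ω ≤ x ∧ X (t + 1) ω ≤ y} = C (cdf ν x) (cdf ν y)
  markov : ∀ t < n, ∀ B : Set ℝ, MeasurableSet B →
    P⟦X (t + 1) ⁻¹' B | ⨆ (s : ℕ) (_ : s ≤ t), MeasurableSpace.comap (X s) inferInstance⟧
      =ᵐ[P] P⟦X (t + 1) ⁻¹' B | MeasurableSpace.comap (X t) inferInstance⟧

/-- The sample mean `(X 0 + ⋯ + X n) / (n + 1)`. -/
def sampleMean {Ω : Type*} (X : ℕ → Ω → ℝ) (n : ℕ) (ω : Ω) : ℝ :=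
  (∑ t ∈ Finset.range (n + 1), X t ω) / (n + 1 : ℝ)

/-- The variance of the limiting normal distribution. -/
def limitVariance (a p : ℝ) : ℝ :=
  if p < 1 / 2 then p * (1 - p) * (1 + a - 2 * p) / (1 - a)
  else p * (1 - p) * (a + 2 * p - 1) / (1 - a)

/-- The limiting variance is positive, so nothing is lost when it is read as an element of `ℝ≥0`. -/
theorem limitVariance_pos {a p : ℝ} (ha0 : 0 < a) (ha1 : a < 1) (hp0 : 0 < p) (hp1 : p < 1) :
    0 < limitVariance a p := by
  unfold limitVariance
  have h1 : 0 < 1 - a := by linarith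
  have h2 : 0 < p * (1 - p) := mul_pos hp0 (by linarith)
  split_ifs with h
  · exact div_pos (mul_pos h2 (by linarith)) h1
  · exact div_pos (mul_pos h2 (by linarith)) h1

end

/-! The proof computes characteristic functions. Write `V k = X k - p` and let `S k` be the sum of
the first `k` of these. Since `V k` takes two values, `exp (i θ V k)` is affine in `V k`, and its
square is affine too; the copula and the Markov property give `E[V (k + 1) | past] = l * V k`. Hence
`u k = E exp (i θ S k)` and `w k = E (exp (i θ S k) V k)` satisfy a closed linear recursion
(`IsCopulaMarkovChain.isCharRecursion`).

For small `θ`, `w` stays of order `θ`. The corrected quantity `u + i θ w / (1 - l)` is then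
multiplied at each step by `exp (-s θ² / 2)` up to `O(θ³)`, where `s = p (1 - p) (1 + l) / (1 - l)`
(`IsCharRecursion.exists_norm_sub_exp_le`). With `θ = t / √(n + 1)` the accumulated error `n |θ|³ +
|θ|` vanishes, `s` equals `limitVariance a p` (`exists_frechetCopula_eq`), and Lévy's continuity
theorem concludes. -/

/-- The mean of `exp (i θ V)`, where `V` is a centred Bernoulli variable. -/
noncomputable def expMean (p θ : ℝ) : ℂ :=
  (1 - p) * Complex.exp (-(p * θ : ℝ) * Complex.I) + p * Complex.exp (((1 - p) * θ : ℝ) * Complex.I)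

/-- The slope of the affine function that agrees with `exp (i θ ·)` at `-p` and `1 - p`. -/
noncomputable def expSlope (p θ : ℝ) : ℂ :=
  Complex.exp (((1 - p) * θ : ℝ) * Complex.I) - Complex.exp (-(p * θ : ℝ) * Complex.I)

/-! ### Taylor estimates for the coefficients of the recursion -/

theorem norm_exp_sub_quadratic_le {z : ℂ} {c h : ℝ} (hc : c ≤ 1) (h0 : 0 ≤ h)
    (h1 : h ≤ 1) (hz : ‖z‖ = c * h) : ‖Complex.exp z - 1 - z - z ^ 2 / 2‖ ≤ 3 * h ^ 3 := by
  have hb := Complex.norm_exp_sub_sum_le_norm_mul_exp z 3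
  have hs : ∑ m ∈ Finset.range 3, z ^ m / (m.factorial : ℂ) = 1 + z + z ^ 2 / 2 := by
    simp [Finset.sum_range_succ, Nat.factorial]
  have hzh : ‖z‖ ≤ h := by rw [hz]; nlinarith
  rw [hs] at hb
  have he : Real.exp ‖z‖ ≤ 3 :=
    (Real.exp_le_exp.2 (hzh.trans h1)).trans (by linarith [Real.exp_one_lt_d9])
  calc ‖Complex.exp z - 1 - z - z ^ 2 / 2‖ = ‖Complex.exp z - (1 + z + z ^ 2 / 2)‖ := by
        congr 1; ring
    _ ≤ ‖z‖ ^ 3 * Real.exp ‖z‖ := hb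
    _ ≤ h ^ 3 * 3 := by gcongr
    _ = 3 * h ^ 3 := by ring

theorem norm_exp_sub_affine_le {z : ℂ} {c h : ℝ} (hc : c ≤ 1) (h0 : 0 ≤ h)
    (h1 : h ≤ 1) (hz : ‖z‖ = c * h) : ‖Complex.exp z - 1 - z‖ ≤ h ^ 2 := by
  have hzh : ‖z‖ ≤ h := by rw [hz]; nlinarith
  refine (Complex.norm_exp_sub_one_sub_id_le (hzh.trans h1)).trans ?_
  gcongr

theorem norm_expMean_sub_le {p θ : ℝ} (hp0 : 0 < p) (hp1 : p < 1) (hθ : |θ| ≤ 1) :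
    ‖expMean p θ - 1 + p * (1 - p) * θ ^ 2 / 2‖ ≤ 3 * |θ| ^ 3 := by
  have b1 := norm_exp_sub_quadratic_le (z := -(p * θ : ℝ) * Complex.I) hp1.le
    (abs_nonneg θ) hθ (by simp [abs_of_pos hp0])
  have b2 := norm_exp_sub_quadratic_le (z := ((1 - p) * θ : ℝ) * Complex.I) (c := 1 - p)
    (by linarith) (abs_nonneg θ) hθ
    (by rw [norm_mul, Complex.norm_I, mul_one, Complex.norm_real, Real.norm_eq_abs, abs_mul,
          abs_of_pos (by linarith : 0 < 1 - p)])
  rw [expMean]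
  set e1 := Complex.exp (-(p * θ : ℝ) * Complex.I)
  set e2 := Complex.exp (((1 - p) * θ : ℝ) * Complex.I)
  have key : (1 - p) * e1 + p * e2 - 1 + p * (1 - p) * θ ^ 2 / 2
      = ((1 - p : ℝ) : ℂ) * (e1 - 1 - (-(p * θ : ℝ) * Complex.I)
          - (-(p * θ : ℝ) * Complex.I) ^ 2 / 2)
        + (p : ℂ) * (e2 - 1 - (((1 - p) * θ : ℝ) * Complex.I)
          - (((1 - p) * θ : ℝ) * Complex.I) ^ 2 / 2) := by
    push_cast
    linear_combination ((1 - p : ℂ) * p * θ ^ 2 / 2) * Complex.I_sq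
  rw [key]
  refine (norm_add_le _ _).trans ?_
  rw [norm_mul, norm_mul, Complex.norm_real, Complex.norm_real, Real.norm_eq_abs,
    Real.norm_eq_abs, abs_of_pos hp0, abs_of_pos (by linarith : 0 < 1 - p)]
  nlinarith

theorem norm_expSlope_sub_le {p θ : ℝ} (hp0 : 0 < p) (hp1 : p < 1) (hθ : |θ| ≤ 1) :
    ‖expSlope p θ - Complex.I * θ‖ ≤ 2 * |θ| ^ 2 := by
  have b1 := norm_exp_sub_affine_le (z := -(p * θ : ℝ) * Complex.I) hp1.le
    (abs_nonneg θ) hθ (by simp [abs_of_pos hp0])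
  have b2 := norm_exp_sub_affine_le (z := ((1 - p) * θ : ℝ) * Complex.I) (c := 1 - p)
    (by linarith) (abs_nonneg θ) hθ
    (by rw [norm_mul, Complex.norm_I, mul_one, Complex.norm_real, Real.norm_eq_abs, abs_mul,
          abs_of_pos (by linarith : 0 < 1 - p)])
  rw [expSlope]
  set e1 := Complex.exp (-(p * θ : ℝ) * Complex.I)
  set e2 := Complex.exp (((1 - p) * θ : ℝ) * Complex.I)
  have key : e2 - e1 - Complex.I * θ
      = (e2 - 1 - (((1 - p) * θ : ℝ) * Complex.I)) - (e1 - 1 - (-(p * θ : ℝ) * Complex.I)) := by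
    push_cast
    ring
  rw [key]
  refine (norm_sub_le _ _).trans ?_
  linarith

theorem norm_expMean_sub_one_le {p θ : ℝ} (hp0 : 0 < p) (hp1 : p < 1) (hθ : |θ| ≤ 1) :
    ‖expMean p θ - 1‖ ≤ 4 * |θ| ^ 2 := by
  have h := norm_expMean_sub_le hp0 hp1 hθ
  have hn : ‖(p * (1 - p) * θ ^ 2 / 2 : ℂ)‖ ≤ |θ| ^ 2 := by
    have : (p * (1 - p) * θ ^ 2 / 2 : ℂ) = ((p * (1 - p) * θ ^ 2 / 2 : ℝ) : ℂ) := by push_cast; ring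
    rw [this, Complex.norm_real, Real.norm_eq_abs, sq_abs, abs_of_nonneg]
    · nlinarith [mul_nonneg hp0.le hp0.le, sq_nonneg θ, mul_pos hp0 (sub_pos.2 hp1),
        mul_nonneg (by nlinarith : 0 ≤ 1 - p * (1 - p)) (sq_nonneg θ)]
    · have := mul_nonneg (mul_pos hp0 (sub_pos.2 hp1)).le (sq_nonneg θ)
      linarith
  have h3 : |θ| ^ 3 ≤ |θ| ^ 2 := pow_le_pow_of_le_one (abs_nonneg _) hθ (by norm_num)
  calc ‖expMean p θ - 1‖
      = ‖(expMean p θ - 1 + p * (1 - p) * θ ^ 2 / 2) - (p * (1 - p) * θ ^ 2 / 2 : ℂ)‖ := by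
        congr 1; ring
    _ ≤ _ := norm_sub_le _ _
    _ ≤ 4 * |θ| ^ 2 := by linarith

theorem norm_expSlope_le {p θ : ℝ} (hp0 : 0 < p) (hp1 : p < 1) (hθ : |θ| ≤ 1) :
    ‖expSlope p θ‖ ≤ 3 * |θ| := by
  have h := norm_expSlope_sub_le hp0 hp1 hθ
  have h2 : |θ| ^ 2 ≤ |θ| := by nlinarith [abs_nonneg θ]
  calc ‖expSlope p θ‖ = ‖(expSlope p θ - Complex.I * θ) + Complex.I * θ‖ := by congr 1; ring
    _ ≤ _ := norm_add_le _ _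
    _ ≤ 3 * |θ| := by
      rw [norm_mul, Complex.norm_I, one_mul, Complex.norm_real, Real.norm_eq_abs]; linarith

/-! ### Analysis of the linear recursion -/

/-- Since `‖r‖ ≤ 1`, earlier errors are never amplified, so they only add up. -/
theorem norm_sub_pow_mul_le {z : ℕ → ℂ} {r : ℂ} {ε : ℝ} (hr : ‖r‖ ≤ 1) {n : ℕ}
    (h : ∀ k < n, ‖z (k + 1) - r * z k‖ ≤ ε) : ‖z n - r ^ n * z 0‖ ≤ n * ε := by
  induction n with
  | zero => simp
  | succ m ih =>
    have hm := ih fun k hk ↦ h k (by omega)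
    have h' := h m (by omega)
    calc ‖z (m + 1) - r ^ (m + 1) * z 0‖
        = ‖(z (m + 1) - r * z m) + r * (z m - r ^ m * z 0)‖ := by congr 1; ring
      _ ≤ ‖z (m + 1) - r * z m‖ + ‖r‖ * ‖z m - r ^ m * z 0‖ := by
        rw [← norm_mul]; exact norm_add_le _ _
      _ ≤ ε + 1 * (m * ε) := by gcongr
      _ = (m + 1 : ℕ) * ε := by push_cast; ring

/-- The linear recursion satisfied by the pair `(E exp (i θ S), E (exp (i θ S) V))` along a
stationary two-state chain with autocorrelation `l`, up to time `n`. -/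
structure IsCharRecursion (p l θ : ℝ) (n : ℕ) (u w : ℕ → ℂ) : Prop where
  u_zero : u 0 = 1
  w_zero : w 0 = 0
  norm_le : ∀ k ≤ n, ‖u k‖ ≤ 1
  u_succ : ∀ k ≤ n, u (k + 1) = expMean p θ * u k + expSlope p θ * w k
  w_succ : ∀ k < n, w (k + 1) = l * (expSlope p θ * (p * (1 - p)) * u k
    + (expMean p θ + expSlope p θ * (1 - 2 * p)) * w k)

/-- The coefficient of `w k` is at most `|l| (1 + 7 |θ|) ≤ (1 + |l|) / 2 < 1`, which is where the 14
comes from. The forcing term is at most `3 |θ|`, and `K = 6 / (1 - |l|)` solves `3 + K (1 + |l|) / 2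
= K`. -/
theorem IsCharRecursion.norm_w_le {p l θ : ℝ} {n : ℕ} {u w : ℕ → ℂ}
    (h : IsCharRecursion p l θ n u w) (hp0 : 0 < p) (hp1 : p < 1) (hl : |l| < 1)
    (hθ : |θ| ≤ (1 - |l|) / 14) : ∀ k ≤ n, ‖w k‖ ≤ 6 / (1 - |l|) * |θ| := by
  have h1 : |θ| ≤ 1 := by linarith [abs_nonneg l]
  have hA := norm_expMean_sub_one_le hp0 hp1 h1
  have hB := norm_expSlope_le hp0 hp1 h1
  have hl' : 0 < 1 - |l| := by linarith
  intro k
  induction k with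
  | zero => intro _; rw [h.w_zero, norm_zero]; positivity
  | succ k ih =>
    intro hk
    have hw := ih (by omega)
    have hu := h.norm_le k (by omega)
    rw [h.w_succ k (by omega), norm_mul, Complex.norm_real, Real.norm_eq_abs]
    have hpq : ‖(p * (1 - p) : ℂ)‖ ≤ 1 := by
      have : (p * (1 - p) : ℂ) = ((p * (1 - p) : ℝ) : ℂ) := by push_cast; ring
      rw [this, Complex.norm_real, Real.norm_eq_abs, abs_of_pos (mul_pos hp0 (by linarith))]
      nlinarith
    have h12 : ‖(1 - 2 * p : ℂ)‖ ≤ 1 := by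
      have : (1 - 2 * p : ℂ) = ((1 - 2 * p : ℝ) : ℂ) := by push_cast; ring
      rw [this, Complex.norm_real, Real.norm_eq_abs, abs_le]
      constructor <;> linarith
    have c1 : ‖expSlope p θ * (p * (1 - p)) * u k‖ ≤ 3 * |θ| := by
      rw [norm_mul, norm_mul]
      calc ‖expSlope p θ‖ * ‖(p * (1 - p) : ℂ)‖ * ‖u k‖ ≤ (3 * |θ|) * 1 * 1 := by gcongr
        _ = 3 * |θ| := by ring
    have c2 : ‖expMean p θ + expSlope p θ * (1 - 2 * p)‖ ≤ 1 + 7 * |θ| := by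
      have : expMean p θ + expSlope p θ * (1 - 2 * p)
        = 1 + ((expMean p θ - 1) + expSlope p θ * (1 - 2 * p)) := by ring
      rw [this]
      refine (norm_add_le _ _).trans ?_
      have e1 : ‖expSlope p θ * (1 - 2 * p)‖ ≤ 3 * |θ| := by
        rw [norm_mul]
        calc _ ≤ (3 * |θ|) * 1 := by gcongr
          _ = _ := by ring
      have e2 := norm_add_le (expMean p θ - 1) (expSlope p θ * (1 - 2 * p))
      have e3 : |θ| ^ 2 ≤ |θ| := by nlinarith [abs_nonneg θ]
      rw [norm_one]
      linarith
    set K := 6 / (1 - |l|) with hK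
    have hK0 : 0 < K := by positivity
    have hKl : K * (1 - |l|) = 6 := by rw [hK]; field_simp
    have c3 : |l| * (1 + 7 * |θ|) ≤ (1 + |l|) / 2 := by
      nlinarith [abs_nonneg l, abs_nonneg θ]
    calc |l| * ‖expSlope p θ * (p * (1 - p)) * u k
          + (expMean p θ + expSlope p θ * (1 - 2 * p)) * w k‖
        ≤ |l| * (3 * |θ| + (1 + 7 * |θ|) * (K * |θ|)) := by
          gcongr
          refine (norm_add_le _ _).trans ?_
          rw [norm_mul (expMean p θ + _)]
          gcongr
      _ = |l| * (3 * |θ|) + |l| * (1 + 7 * |θ|) * (K * |θ|) := by ring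
      _ ≤ 1 * (3 * |θ|) + (1 + |l|) / 2 * (K * |θ|) := by gcongr
      _ = (3 - K * (1 - |l|) / 2 + K) * |θ| := by ring
      _ = K * |θ| := by rw [hKl]; ring

theorem IsCharRecursion.exists_norm_sub_exp_le {p l : ℝ} (hp0 : 0 < p) (hp1 : p < 1)
    (hl : |l| < 1) : ∃ c : ℝ, ∀ θ : ℝ, |θ| ≤ (1 - |l|) / 14 → ∀ (n : ℕ) (u w : ℕ → ℂ),
      IsCharRecursion p l θ n u w →
      ‖u (n + 1) - ((Real.exp (-(p * (1 - p) * ((1 + l) / (1 - l)) * θ ^ 2 / 2)) ^ n : ℝ) : ℂ)‖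
        ≤ c * (n * |θ| ^ 3 + |θ|) := by
  have hl' : 0 < 1 - |l| := by linarith
  have hl1 : 0 < 1 - l := by linarith [le_abs_self l]
  have hl2 : 0 < 1 + l := by linarith [neg_abs_le l]
  obtain ⟨g, hg⟩ : ∃ g, g = 1 / (1 - l) := ⟨_, rfl⟩
  have hg0 : 0 < g := by rw [hg]; positivity
  have hgl : g * l = g - 1 := by rw [hg]; field_simp; ring
  obtain ⟨K, hK⟩ : ∃ K, K = 6 / (1 - |l|) := ⟨_, rfl⟩
  have hK0 : 0 < K := by rw [hK]; positivity
  obtain ⟨s, hs⟩ : ∃ s, s = p * (1 - p) * ((1 + l) / (1 - l)) := ⟨_, rfl⟩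
  have hq : 0 < 1 - p := by linarith
  have hs0 : 0 < s := by rw [hs]; positivity
  have hsg : s = p * (1 - p) * (2 * g - 1) := by rw [hs, hg]; field_simp; ring
  obtain ⟨E, hE⟩ : ∃ E, E = 3 + 2 * g + (2 + 7 * g + g * s) * K
    + s ^ 2 * Real.exp s * (1 + g * K) := ⟨_, rfl⟩
  have hE0 : 0 ≤ E := by rw [hE]; positivity
  rw [← hs]
  refine ⟨E + (4 + 3 * K + g * K), fun θ hθ n u w h ↦ ?_⟩
  have h1 : |θ| ≤ 1 := by linarith [abs_nonneg l]
  have hA2 := norm_expMean_sub_le hp0 hp1 h1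
  have hA1 := norm_expMean_sub_one_le hp0 hp1 h1
  have hB2 := norm_expSlope_sub_le hp0 hp1 h1
  have hB1 := norm_expSlope_le hp0 hp1 h1
  have hw := h.norm_w_le hp0 hp1 hl hθ
  rw [← hK] at hw
  obtain ⟨r, hr⟩ : ∃ r, r = Real.exp (-(s * θ ^ 2 / 2)) := ⟨_, rfl⟩
  have hr0 : 0 < r := by rw [hr]; exact Real.exp_pos _
  have hr1 : r ≤ 1 := by
    rw [hr]; apply Real.exp_le_one_iff.2
    have := mul_nonneg hs0.le (sq_nonneg θ); linarith
  rw [← hr]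
  set A := expMean p θ
  set B := expSlope p θ
  obtain ⟨x, hx⟩ : ∃ x, x = |θ| := ⟨_, rfl⟩
  have hx0 : 0 ≤ x := hx ▸ abs_nonneg _
  have hx2 : θ ^ 2 = x ^ 2 := by rw [hx, sq_abs]
  have hθn : ‖(θ : ℂ)‖ = x := by rw [Complex.norm_real, Real.norm_eq_abs, hx]
  rw [← hx] at h1 hw hA1 hA2 hB1 hB2 ⊢
  have hgn : ‖(g : ℂ)‖ = g := by rw [Complex.norm_real, Real.norm_of_nonneg hg0.le]
  have hln : ‖(l : ℂ)‖ ≤ 1 := by rw [Complex.norm_real, Real.norm_eq_abs]; exact hl.le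
  have hpq : ‖(p * (1 - p) : ℂ)‖ ≤ 1 := by
    have : (p * (1 - p) : ℂ) = ((p * (1 - p) : ℝ) : ℂ) := by push_cast; ring
    rw [this, Complex.norm_real, Real.norm_of_nonneg (mul_pos hp0 hq).le]
    nlinarith
  have h12 : ‖(1 - 2 * p : ℂ)‖ ≤ 1 := by
    have : (1 - 2 * p : ℂ) = ((1 - 2 * p : ℝ) : ℂ) := by push_cast; ring
    rw [this, Complex.norm_real, Real.norm_eq_abs, abs_le]
    constructor <;> linarith
  have hsn : ‖(s : ℂ)‖ = s := by rw [Complex.norm_real, Real.norm_of_nonneg hs0.le]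
  have hx43 : x ^ 4 ≤ x ^ 3 := pow_le_pow_of_le_one hx0 h1 (by norm_num)
  have hx21 : x ^ 2 ≤ x := by nlinarith
  -- The corrector `i θ g w` is chosen to absorb the first-order term `i θ w k` in the recursion for
  -- `u`: this requires `1 + g l = g`, that is `g = 1 / (1 - l)`.
  obtain ⟨z, hz⟩ : ∃ z : ℕ → ℂ, z = fun k ↦ u k + Complex.I * θ * g * w k := ⟨_, rfl⟩
  have hzu : ∀ k ≤ n, ‖z k - u k‖ ≤ g * K * x ^ 2 := by
    intro k hk
    have : z k - u k = Complex.I * θ * g * w k := by rw [hz]; ring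
    rw [this, norm_mul, norm_mul, norm_mul, Complex.norm_I, hθn, hgn]
    calc 1 * x * g * ‖w k‖ ≤ 1 * x * g * (K * x) := by gcongr; exact hw k hk
      _ = _ := by ring
  have hzn : ∀ k ≤ n, ‖z k‖ ≤ 1 + g * K := by
    intro k hk
    calc ‖z k‖ = ‖u k + (z k - u k)‖ := by congr 1; ring
      _ ≤ ‖u k‖ + ‖z k - u k‖ := norm_add_le _ _
      _ ≤ 1 + g * K * 1 := by
        refine add_le_add (h.norm_le k hk) ((hzu k hk).trans ?_)
        gcongr
        exact hx21.trans h1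
      _ = _ := by ring
  have hrs : ‖(1 - s * θ ^ 2 / 2 - r : ℂ)‖ ≤ s ^ 2 * Real.exp s * x ^ 3 := by
    have hb := Complex.norm_exp_sub_sum_le_norm_mul_exp ((-(s * θ ^ 2 / 2) : ℝ) : ℂ) 2
    have e1 : (1 - s * θ ^ 2 / 2 - r : ℂ) = -(Complex.exp ((-(s * θ ^ 2 / 2) : ℝ) : ℂ)
        - ∑ m ∈ Finset.range 2, ((-(s * θ ^ 2 / 2) : ℝ) : ℂ) ^ m / (m.factorial : ℂ)) := by
      rw [hr]
      simp [Finset.sum_range_succ, Nat.factorial]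
      ring
    rw [e1, norm_neg]
    refine hb.trans ?_
    have hnn : 0 ≤ s * x ^ 2 / 2 := by positivity
    rw [Complex.norm_real, norm_neg, hx2, Real.norm_of_nonneg hnn]
    calc (s * x ^ 2 / 2) ^ 2 * Real.exp (s * x ^ 2 / 2)
        ≤ (s * x ^ 2) ^ 2 * Real.exp s := by
          have : s * x ^ 2 ≤ s * 1 := by gcongr; exact hx21.trans h1
          gcongr <;> linarith
      _ = s ^ 2 * Real.exp s * x ^ 4 := by ring
      _ ≤ _ := by gcongr
  have hstep : ∀ k < n, ‖z (k + 1) - (r : ℂ) * z k‖ ≤ E * x ^ 3 := by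
    intro k hk
    have huk := h.norm_le k hk.le
    have hwk := hw k hk.le
    have hglc : (g : ℂ) * l = g - 1 := by exact_mod_cast hgl
    have hsgc : (s : ℂ) = p * (1 - p) * (2 * g - 1) := by exact_mod_cast hsg
    -- Besides the cancellation in `w k`, the `θ²` coefficients of `u k` combine to `-p (1 - p) (1 /
    -- 2 + g l) = -s / 2`, so every remaining term is `O(θ³)`.
    have key : z (k + 1) - (r : ℂ) * z k
        = ((A - 1 + p * (1 - p) * θ ^ 2 / 2)
            + Complex.I * θ * g * l * (p * (1 - p)) * (B - Complex.I * θ)) * u k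
          + ((B - Complex.I * θ) + Complex.I * θ * g * l * (A - 1)
            + Complex.I * θ * g * l * (1 - 2 * p) * B
            + Complex.I * θ * g * s * θ ^ 2 / 2) * w k
          + (1 - s * θ ^ 2 / 2 - r) * z k := by
      rw [hz]
      simp only [h.u_succ k hk.le, h.w_succ k hk]
      rw [hsgc]
      linear_combination (Complex.I * θ * w k - u k * (p * (1 - p)) * θ ^ 2) * hglc
        + (θ ^ 2 * u k * (p * (1 - p)) * g * l) * Complex.I_sq
    rw [key]
    have t1 : ‖((A - 1 + p * (1 - p) * θ ^ 2 / 2)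
            + Complex.I * θ * g * l * (p * (1 - p)) * (B - Complex.I * θ)) * u k‖
          ≤ (3 * x ^ 3 + 1 * x * g * 1 * 1 * (2 * x ^ 2)) * 1 := by
      rw [norm_mul]
      gcongr
      refine (norm_add_le _ _).trans ?_
      rw [norm_mul, norm_mul, norm_mul, norm_mul, norm_mul Complex.I, Complex.norm_I, hθn, hgn]
      gcongr
    have t2 : ‖((B - Complex.I * θ) + Complex.I * θ * g * l * (A - 1)
            + Complex.I * θ * g * l * (1 - 2 * p) * B
            + Complex.I * θ * g * s * θ ^ 2 / 2) * w k‖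
          ≤ (2 * x ^ 2 + 1 * x * g * 1 * (4 * x ^ 2) + 1 * x * g * 1 * 1 * (3 * x)
            + 1 * x * g * s * x ^ 2 / 1) * (K * x) := by
      rw [norm_mul]
      gcongr
      refine (norm_add_le _ _).trans (add_le_add ((norm_add_le _ _).trans (add_le_add
        ((norm_add_le _ _).trans (add_le_add hB2 ?_)) ?_)) ?_)
      · simp only [norm_mul, Complex.norm_I, hθn, hgn]
        gcongr
      · rw [norm_mul, norm_mul, norm_mul, norm_mul, norm_mul Complex.I, Complex.norm_I, hθn, hgn]
        gcongr
      · simp only [norm_mul, norm_div, norm_pow, Complex.norm_I, hθn, hgn, hsn]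
        have : (1 : ℝ) ≤ ‖(2 : ℂ)‖ := by norm_num
        gcongr
    have t3 : ‖(1 - s * θ ^ 2 / 2 - r : ℂ) * z k‖
        ≤ (s ^ 2 * Real.exp s * x ^ 3) * (1 + g * K) := by
      rw [norm_mul]
      gcongr
      exact hzn k hk.le
    refine (norm_add_le _ _).trans ((add_le_add ((norm_add_le _ _).trans
      (add_le_add t1 t2)) t3).trans ?_)
    rw [hE]
    have e1 : g * K * x ^ 4 ≤ g * K * x ^ 3 := by gcongr
    have e2 : g * s * K * x ^ 4 ≤ g * s * K * x ^ 3 := by gcongr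
    linarith
  have hfin := norm_sub_pow_mul_le (z := z) (r := (r : ℂ))
    (by rw [Complex.norm_real, Real.norm_of_nonneg hr0.le]; exact hr1) hstep
  have hz0 : z 0 = 1 := by rw [hz]; simp [h.u_zero, h.w_zero]
  rw [hz0, mul_one] at hfin
  -- The recursion for `w` stops at time `n`, so the last step of `u` is taken separately; it costs
  -- only `O(θ²)`, and the power of `r` is `n`.
  have hsplit : u (n + 1) - ((r ^ n : ℝ) : ℂ)
      = (A - 1) * u n + B * w n - (z n - u n) + (z n - (r : ℂ) ^ n) := by
    rw [h.u_succ n le_rfl]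
    push_cast
    ring
  rw [hsplit]
  have t1 : ‖(A - 1) * u n‖ ≤ 4 * x ^ 2 * 1 := by
    rw [norm_mul]; gcongr; exact h.norm_le n le_rfl
  have t2 : ‖B * w n‖ ≤ 3 * x * (K * x) := by
    rw [norm_mul]; gcongr; exact hw n le_rfl
  refine (norm_add_le _ _).trans ((add_le_add ((norm_sub_le _ _).trans
    (add_le_add ((norm_add_le _ _).trans (add_le_add t1 t2)) (hzu n le_rfl))) hfin).trans ?_)
  have e1 : (4 + 3 * K + g * K) * x ^ 2 ≤ (4 + 3 * K + g * K) * x := by gcongr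
  have e2 : 0 ≤ E * x := by positivity
  have e3 : 0 ≤ (4 + 3 * K + g * K) * (n * x ^ 3) := by positivity
  linarith


/-! ### From the Markov chain to the recursion -/

theorem exp_mul_I_eq_expMean_add {p θ x : ℝ} (hx : x = 0 ∨ x = 1) :
    Complex.exp ((θ * (x - p) : ℝ) * Complex.I) = expMean p θ + expSlope p θ * (x - p : ℝ) := by
  rw [expMean, expSlope]
  rcases hx with rfl | rfl
  · have : θ * (0 - p) = -(p * θ) := by ring
    rw [this]
    push_cast
    ring
  · have : θ * (1 - p) = (1 - p) * θ := by ring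
    rw [this]
    push_cast
    ring

/-- The exponential of the centred partial sum of the first `k` variables. -/
noncomputable def expSum {Ω : Type*} (p θ : ℝ) (X : ℕ → Ω → ℝ) (k : ℕ) (ω : Ω) : ℂ :=
  Complex.exp ((θ * ∑ t ∈ Finset.range k, (X t ω - p) : ℝ) * Complex.I)

theorem norm_expSum {Ω : Type*} (p θ : ℝ) (X : ℕ → Ω → ℝ) (k : ℕ) (ω : Ω) : ‖expSum p θ X k ω‖ = 1 :=
  Complex.norm_exp_ofReal_mul_I _

theorem expSum_succ {Ω : Type*} {p θ : ℝ} {X : ℕ → Ω → ℝ} {k : ℕ} {ω : Ω} (h : X k ω = 0 ∨ X k ω = 1) :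
    expSum p θ X (k + 1) ω
      = (expMean p θ + expSlope p θ * (X k ω - p : ℝ)) * expSum p θ X k ω := by
  rw [← exp_mul_I_eq_expMean_add h, expSum, expSum, ← Complex.exp_add, Finset.sum_range_succ]
  congr 1
  push_cast
  ring

theorem measurable_expSum {Ω : Type*} {m : MeasurableSpace Ω} (p θ : ℝ) {X : ℕ → Ω → ℝ} {k : ℕ}
    (h : ∀ t < k, Measurable (X t)) : Measurable (expSum p θ X k) := by
  have : Measurable fun ω ↦ ∑ t ∈ Finset.range k, (X t ω - p) :=
    Finset.measurable_sum _ fun t ht ↦ (h t (Finset.mem_range.1 ht)).sub_const p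
  unfold expSum
  fun_prop

theorem integral_mul_eq_of_condExp_eq {Ω : Type*} {m mΩ : MeasurableSpace Ω} {P : Measure Ω}
    [IsFiniteMeasure P] (hle : m ≤ mΩ) {V V' : Ω → ℝ} {G : Ω → ℂ} {l : ℝ}
    (hG : StronglyMeasurable[m] G) (hV' : Integrable V' P)
    (hVG : Integrable (fun ω ↦ (V' ω : ℂ) * G ω) P)
    (hce : P[V' | m] =ᵐ[P] fun ω ↦ l * V ω) :
    ∫ ω, (V' ω : ℂ) * G ω ∂P = l * ∫ ω, (V ω : ℂ) * G ω ∂P := by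
  have heq : V' • G = fun ω ↦ (V' ω : ℂ) * G ω := by
    ext ω
    simp
  have hpull := condExp_smul_of_aestronglyMeasurable_right (m := m) (μ := P)
    (f := V') (g := G) hV' (heq ▸ hVG) hG.aestronglyMeasurable
  rw [heq] at hpull
  rw [← integral_condExp hle, ← integral_const_mul]
  refine integral_congr_ae ?_
  filter_upwards [hpull, hce] with ω a1 a2
  rw [a1, Pi.smul_apply', a2, Complex.real_smul]
  push_cast
  ring

theorem cdf_bernoulliMeasure_zero (p : unitInterval) :
    cdf (bernoulliMeasure (1 : ℝ) 0 p) 0 = 1 - p := by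
  classical
  rw [cdf_eq_real, bernoulliMeasure_real_apply p measurableSet_Iic]
  simp

section TwoState

variable {Ω : Type*} [mΩ : MeasurableSpace Ω] {P : Measure Ω}

theorem IsCopulaMarkovChain.ae_zero_or_one {C : ℝ → ℝ → ℝ} {p : unitInterval} {n : ℕ}
    {X : ℕ → Ω → ℝ} (h : IsCopulaMarkovChain P C (bernoulliMeasure (1 : ℝ) 0 p) n X)
    {t : ℕ} (ht : t ≤ n) : ∀ᵐ ω ∂P, X t ω = 0 ∨ X t ω = 1 := by
  have hm : MeasurableSet {x : ℝ | x = 0 ∨ x = 1} :=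
    (measurableSet_singleton 0).union (measurableSet_singleton 1)
  rw [(h.hasLaw t ht).ae_iff (p := fun x ↦ x = 0 ∨ x = 1) (measurableSet_setOfPred.1 hm), ae_iff]
  classical
  rw [show {a : ℝ | ¬(a = 0 ∨ a = 1)} = {x : ℝ | x = 0 ∨ x = 1}ᶜ from rfl,
    bernoulliMeasure_apply p hm.compl]
  simp

theorem IsCopulaMarkovChain.integral_eq {C : ℝ → ℝ → ℝ} {p : unitInterval} {n : ℕ}
    {X : ℕ → Ω → ℝ} (h : IsCopulaMarkovChain P C (bernoulliMeasure (1 : ℝ) 0 p) n X)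
    {t : ℕ} (ht : t ≤ n) : ∫ ω, X t ω ∂P = p := by
  have hl := h.hasLaw t ht
  have := integral_map (f := fun x : ℝ ↦ x) hl.aemeasurable (by fun_prop)
  rw [← this, hl.map_eq, integral_bernoulliMeasure]
  simp

variable [IsProbabilityMeasure P]

theorem integrable_of_ae_zero_or_one {X : Ω → ℝ} (hX : Measurable X)
    (h01 : ∀ᵐ ω ∂P, X ω = 0 ∨ X ω = 1) : Integrable X P := by
  refine Integrable.of_bound hX.aestronglyMeasurable 1 ?_
  filter_upwards [h01] with ω h
  rcases h with h | h <;> simp [h]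

/-- For a `{0, 1}`-valued variable, conditioning on it is linear regression. -/
theorem condExp_comap_eq_of_ae_zero_or_one {X Y : Ω → ℝ} (hX : Measurable X)
    (h01 : ∀ᵐ ω ∂P, X ω = 0 ∨ X ω = 1) (hY : Measurable Y)
    (hY01 : ∀ᵐ ω ∂P, Y ω = 0 ∨ Y ω = 1) {p l : ℝ} (hp0 : 0 < p) (hp1 : p < 1)
    (hXp : ∫ ω, X ω ∂P = p) (hYp : ∫ ω, Y ω ∂P = p)
    (hXY : ∫ ω, X ω * Y ω ∂P = p ^ 2 + l * (p * (1 - p))) :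
    P[Y | MeasurableSpace.comap X inferInstance] =ᵐ[P] fun ω ↦ p + l * (X ω - p) := by
  have hle : MeasurableSpace.comap X inferInstance ≤ mΩ := hX.comap_le
  have hXi := integrable_of_ae_zero_or_one hX h01
  have hYi := integrable_of_ae_zero_or_one hY hY01
  have hXYi : Integrable (X * Y) P := by
    refine hYi.bdd_mul hX.aestronglyMeasurable (c := 1) ?_
    filter_upwards [h01] with ω h
    rcases h with h | h <;> simp [h]
  -- The conditional expectation is a function `h` of `X`, hence affine in `X` on `{0, 1}`.
  -- Integrating it alone and against `X` gives two linear equations that determine `h 0` and `h 1`.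
  obtain ⟨h, -, hh⟩ := (stronglyMeasurable_condExp (μ := P) (f := Y)
    (m := MeasurableSpace.comap X inferInstance)).exists_eq_measurable_comp
  have hlin : P[Y | MeasurableSpace.comap X inferInstance]
      =ᵐ[P] fun ω ↦ h 0 + (h 1 - h 0) * X ω := by
    filter_upwards [h01] with ω h'
    rw [hh]
    rcases h' with h' | h' <;> simp [h']
  have e1 : h 0 + (h 1 - h 0) * p = p := by
    have := integral_condExp (μ := P) (f := Y) hle
    rw [integral_congr_ae hlin, integral_add (integrable_const _) (hXi.const_mul _),
      integral_const_mul, hXp, hYp] at this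
    simpa using this
  have e2 : h 1 * p = p ^ 2 + l * (p * (1 - p)) := by
    have hpull := condExp_mul_of_stronglyMeasurable_left (μ := P) (f := X) (g := Y)
      (m := MeasurableSpace.comap X inferInstance)
      (comap_measurable X).stronglyMeasurable hXYi hYi
    have := integral_condExp (μ := P) (f := X * Y) hle
    rw [integral_congr_ae hpull] at this
    have hc : X * P[Y | MeasurableSpace.comap X inferInstance] =ᵐ[P] fun ω ↦ h 1 * X ω := by
      filter_upwards [h01] with ω h'
      rw [Pi.mul_apply, hh]
      rcases h' with h' | h' <;> simp [h']
    rw [integral_congr_ae hc, integral_const_mul, hXp] at this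
    rw [this, ← hXY]
    rfl
  have hq : 1 - p ≠ 0 := by linarith
  have e3 : h 1 = p + l * (1 - p) := by
    apply mul_right_cancel₀ hp0.ne'
    linear_combination e2
  have e4 : h 1 - h 0 = l := by
    apply mul_right_cancel₀ hq
    linear_combination e3 - e1
  filter_upwards [hlin] with ω hω
  rw [hω, e4]
  linear_combination e1 - p * e4

/-- On `{0, 1}` one has `x y = 1{x ≤ 0, y ≤ 0} - 1 + x + y`, so the joint distribution function is
needed only at `(0, 0)`. -/
theorem IsCopulaMarkovChain.integral_mul_eq {C : ℝ → ℝ → ℝ} {p : unitInterval} {n : ℕ}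
    {X : ℕ → Ω → ℝ} (h : IsCopulaMarkovChain P C (bernoulliMeasure (1 : ℝ) 0 p) n X)
    {t : ℕ} (ht : t < n) :
    ∫ ω, X t ω * X (t + 1) ω ∂P = C (1 - p) (1 - p) - 1 + 2 * p := by
  have h0 := h.ae_zero_or_one ht.le
  have h1 := h.ae_zero_or_one (Nat.succ_le_of_lt ht)
  have m0 := h.measurable t ht.le
  have m1 := h.measurable (t + 1) ht
  have i0 := integrable_of_ae_zero_or_one m0 h0
  have i1 := integrable_of_ae_zero_or_one m1 h1
  have hj := h.joint t ht 0 0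
  have hs : MeasurableSet {ω | X t ω ≤ 0 ∧ X (t + 1) ω ≤ 0} :=
    (measurableSet_le m0 measurable_const).inter (measurableSet_le m1 measurable_const)
  rw [cdf_bernoulliMeasure_zero, ← integral_indicator_one hs] at hj
  have hae : (fun ω ↦ X t ω * X (t + 1) ω) =ᵐ[P] fun ω ↦
      {ω | X t ω ≤ 0 ∧ X (t + 1) ω ≤ 0}.indicator 1 ω - 1 + X t ω + X (t + 1) ω := by
    filter_upwards [h0, h1] with ω a0 a1
    rcases a0 with a0 | a0 <;> rcases a1 with a1 | a1 <;>
      simp [a0, a1, Set.indicator, not_le.2 (zero_lt_one' ℝ)]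
  have is : Integrable (fun ω ↦
      {ω | X t ω ≤ 0 ∧ X (t + 1) ω ≤ 0}.indicator (1 : Ω → ℝ) ω) P :=
    (integrable_const (1 : ℝ)).indicator hs
  have i2 : Integrable (fun ω ↦
      {ω | X t ω ≤ 0 ∧ X (t + 1) ω ≤ 0}.indicator (1 : Ω → ℝ) ω - 1) P :=
    is.sub (integrable_const 1)
  have i3 : Integrable (fun ω ↦
      {ω | X t ω ≤ 0 ∧ X (t + 1) ω ≤ 0}.indicator (1 : Ω → ℝ) ω - 1 + X t ω) P := i2.add i0
  rw [integral_congr_ae hae, integral_add i3 i1, integral_add i2 i0,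
    integral_sub is (integrable_const 1), hj, h.integral_eq ht.le, h.integral_eq ht]
  simp
  ring

/-- The centred chain is a contraction in conditional mean. -/
theorem IsCopulaMarkovChain.condExp_sub_eq {C : ℝ → ℝ → ℝ} {p : unitInterval} {n : ℕ}
    {X : ℕ → Ω → ℝ} (h : IsCopulaMarkovChain P C (bernoulliMeasure (1 : ℝ) 0 p) n X)
    {l : ℝ} (hp0 : 0 < (p : ℝ)) (hp1 : (p : ℝ) < 1)
    (hl : C (1 - p) (1 - p) = (1 - p) ^ 2 + l * (p * (1 - p))) {t : ℕ} (ht : t < n) :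
    P[fun ω ↦ X (t + 1) ω - p |
        ⨆ (s : ℕ) (_ : s ≤ t), MeasurableSpace.comap (X s) inferInstance]
      =ᵐ[P] fun ω ↦ l * (X t ω - p) := by
  have h0 := h.ae_zero_or_one ht.le
  have h1 := h.ae_zero_or_one (Nat.succ_le_of_lt ht)
  have m0 := h.measurable t ht.le
  have m1 := h.measurable (t + 1) ht
  have i1 := integrable_of_ae_zero_or_one m1 h1
  have hreg := condExp_comap_eq_of_ae_zero_or_one m0 h0 m1 h1 hp0 hp1 (h.integral_eq ht.le)
    (h.integral_eq ht) (l := l) (by rw [h.integral_mul_eq ht, hl]; ring)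
  -- The Markov property concerns events; it transfers to `X (t + 1)` because this variable is a.e.
  -- the indicator of `{X (t + 1) = 1}`.
  have hind : (X (t + 1) ⁻¹' {1}).indicator (fun _ ↦ (1 : ℝ)) =ᵐ[P] X (t + 1) := by
    filter_upwards [h1] with ω a
    rcases a with a | a <;> simp [Set.indicator, a]
  have hle : (⨆ (s : ℕ) (_ : s ≤ t), MeasurableSpace.comap (X s) inferInstance) ≤ mΩ :=
    iSup₂_le fun s hs ↦ (h.measurable s (hs.trans ht.le)).comap_le
  have hmk := h.markov t ht {1} (measurableSet_singleton 1)
  have hsub := condExp_sub i1 (integrable_const (p : ℝ))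
    (⨆ (s : ℕ) (_ : s ≤ t), MeasurableSpace.comap (X s) inferInstance)
  rw [condExp_const hle] at hsub
  filter_upwards [hsub, hmk, hreg, condExp_congr_ae (m := MeasurableSpace.comap (X t) _) hind,
    condExp_congr_ae
      (m := ⨆ (s : ℕ) (_ : s ≤ t), MeasurableSpace.comap (X s) inferInstance) hind]
    with ω a1 a2 a3 a4 a5
  have : (fun ω ↦ X (t + 1) ω - (p : ℝ)) = X (t + 1) - fun _ ↦ (p : ℝ) := rfl
  rw [this, a1, Pi.sub_apply, ← a5, a2, a4, a3]
  ring

/-- The sum inside `expSum p θ X (k + 1)` ends at `X k`, so it is known to the past at time `k` and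
`V (k + 1)` may be replaced by `l * V k`. The products are then reduced by `V² = p (1 - p) + (1 - 2
p) V`. -/
theorem IsCopulaMarkovChain.isCharRecursion {C : ℝ → ℝ → ℝ} {p : unitInterval} {n : ℕ}
    {X : ℕ → Ω → ℝ} (h : IsCopulaMarkovChain P C (bernoulliMeasure (1 : ℝ) 0 p) n X)
    {l : ℝ} (hp0 : 0 < (p : ℝ)) (hp1 : (p : ℝ) < 1)
    (hl : C (1 - p) (1 - p) = (1 - p) ^ 2 + l * (p * (1 - p))) (θ : ℝ) :
    IsCharRecursion p l θ n (fun k ↦ ∫ ω, expSum p θ X k ω ∂P)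
      (fun k ↦ ∫ ω, (X k ω - p : ℝ) * expSum p θ X k ω ∂P) := by
  have hEm : ∀ k ≤ n + 1, Measurable (expSum p θ X k) := fun k hk ↦
    measurable_expSum p θ fun t ht ↦ h.measurable t (by omega)
  have hEi : ∀ k ≤ n + 1, Integrable (expSum p θ X k) P := fun k hk ↦
    Integrable.of_bound (hEm k hk).aestronglyMeasurable 1
      (ae_of_all _ fun ω ↦ (norm_expSum p θ X k ω).le)
  have hXi : ∀ k ≤ n, Integrable (X k) P := fun k hk ↦
    integrable_of_ae_zero_or_one (h.measurable k hk) (h.ae_zero_or_one hk)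
  have hVi : ∀ k ≤ n, Integrable (fun ω ↦ X k ω - p) P := fun k hk ↦
    (hXi k hk).sub (integrable_const _)
  have hVEi : ∀ k ≤ n, ∀ j ≤ n + 1,
      Integrable (fun ω ↦ ((X k ω - p : ℝ) : ℂ) * expSum p θ X j ω) P := fun k hk j hj ↦
    (hVi k hk).ofReal.mul_bdd (hEm j hj).aestronglyMeasurable
      (ae_of_all _ fun ω ↦ (norm_expSum p θ X j ω).le)
  refine ⟨?_, ?_, ?_, ?_, ?_⟩
  · simp [expSum]
  · simp only [expSum, Finset.range_zero, Finset.sum_empty, mul_zero, Complex.ofReal_zero,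
      zero_mul, Complex.exp_zero, mul_one]
    rw [integral_complex_ofReal, integral_sub (hXi 0 (Nat.zero_le n)) (integrable_const _),
      h.integral_eq (Nat.zero_le n)]
    simp
  · intro k hk
    refine (norm_integral_le_integral_norm _).trans ?_
    simp [norm_expSum]
  · intro k hk
    have hae : expSum p θ X (k + 1) =ᵐ[P] fun ω ↦ expMean p θ * expSum p θ X k ω
        + expSlope p θ * ((X k ω - p : ℝ) * expSum p θ X k ω) := by
      filter_upwards [h.ae_zero_or_one hk] with ω a
      rw [expSum_succ a]
      ring
    rw [integral_congr_ae hae, integral_add ((hEi k (by omega)).const_mul _)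
      ((hVEi k hk k (by omega)).const_mul _), integral_const_mul, integral_const_mul]
  · intro k hk
    have hle : (⨆ (s : ℕ) (_ : s ≤ k), MeasurableSpace.comap (X s) inferInstance) ≤ mΩ :=
      iSup₂_le fun s hs ↦ (h.measurable s (hs.trans hk.le)).comap_le
    have hae : (fun ω ↦ ((X k ω - p : ℝ) : ℂ) * expSum p θ X (k + 1) ω) =ᵐ[P] fun ω ↦
        expSlope p θ * (p * (1 - p)) * expSum p θ X k ω
          + (expMean p θ + expSlope p θ * (1 - 2 * p))
            * ((X k ω - p : ℝ) * expSum p θ X k ω) := by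
      filter_upwards [h.ae_zero_or_one hk.le] with ω a
      have hsq : (X k ω : ℂ) ^ 2 = X k ω := by rcases a with a | a <;> simp [a]
      rw [expSum_succ a]
      push_cast
      linear_combination (expSlope p θ * expSum p θ X k ω) * hsq
    have hG : StronglyMeasurable[⨆ (s : ℕ) (_ : s ≤ k),
        MeasurableSpace.comap (X s) inferInstance] (expSum p θ X (k + 1)) :=
      (measurable_expSum p θ fun t ht ↦ (comap_measurable (X t)).mono
        (le_iSup₂ (f := fun (s : ℕ) (_ : s ≤ k) ↦ MeasurableSpace.comap (X s) inferInstance)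
          t (Nat.lt_succ_iff.1 ht)) le_rfl).stronglyMeasurable
    rw [integral_mul_eq_of_condExp_eq hle hG
        (hVi (k + 1) hk) (hVEi (k + 1) hk (k + 1) (by omega))
        (h.condExp_sub_eq hp0 hp1 hl hk),
      integral_congr_ae hae, integral_add ((hEi k (by omega)).const_mul _)
      ((hVEi k hk.le k (by omega)).const_mul _), integral_const_mul, integral_const_mul]

end TwoState

/-! ### Autocorrelation for the Fréchet copula -/

/-- The one-step autocorrelation of the chain. -/
theorem exists_frechetCopula_eq {a p : ℝ} (ha0 : 0 < a) (ha1 : a < 1) (hp0 : 0 < p)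
    (hp1 : p < 1) : ∃ l : ℝ, |l| < 1 ∧
      frechetCopula a (1 - p) (1 - p) = (1 - p) ^ 2 + l * (p * (1 - p)) ∧
      limitVariance a p = p * (1 - p) * ((1 + l) / (1 - l)) := by
  have hq : 0 < 1 - p := by linarith
  have ha : 0 < 1 - a := by linarith
  -- In both cases `l = 1 - (1 - a) / m` with `m = max p (1 - p) ≥ 1 / 2`, found by solving the
  -- copula equation; the bounds on `(1 - a) / m` give `|l| < 1`.
  have hd : ∀ m : ℝ, 1 / 2 ≤ m → 0 < (1 - a) / m ∧ (1 - a) / m < 2 := fun m hm ↦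
    ⟨div_pos ha (by linarith), by rw [div_lt_iff₀ (by linarith)]; linarith⟩
  by_cases h : p < 1 / 2
  · obtain ⟨h1, h2⟩ := hd (1 - p) (by linarith)
    refine ⟨1 - (1 - a) / (1 - p), abs_lt.2 ⟨by linarith, by linarith⟩, ?_, ?_⟩
    · rw [frechetCopula, copulaM, copulaW, min_self, max_eq_left (by linarith)]
      field_simp
      ring
    · rw [limitVariance, if_pos h, sub_sub_cancel]
      field_simp
      ring
  · obtain ⟨h1, h2⟩ := hd p (by linarith)
    refine ⟨1 - (1 - a) / p, abs_lt.2 ⟨by linarith, by linarith⟩, ?_, ?_⟩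
    · rw [frechetCopula, copulaM, copulaW, min_self, max_eq_right (by linarith)]
      field_simp
      ring
    · rw [limitVariance, if_neg h, sub_sub_cancel]
      field_simp
      ring

/-! ### Limits at `θ = t / √(n + 1)` and conclusion -/

theorem tendsto_exp_neg_pow (v t : ℝ) :
    Tendsto (fun n : ℕ ↦ Real.exp (-(v * (t / √(n + 1 : ℝ)) ^ 2 / 2)) ^ n) atTop
      (nhds (Real.exp (-(v * t ^ 2 / 2)))) := by
  have he : ∀ n : ℕ, Real.exp (-(v * (t / √(n + 1 : ℝ)) ^ 2 / 2)) ^ n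
      = Real.exp (-(v * t ^ 2 / 2) * (n / (n + 1 : ℝ))) := by
    intro n
    have hn : (0 : ℝ) < n + 1 := by positivity
    rw [← Real.exp_nat_mul, div_pow, Real.sq_sqrt hn.le]
    congr 1
    field_simp
  simp_rw [he]
  have := tendsto_natCast_div_add_atTop (1 : ℝ)
  simpa [Function.comp_def] using (Real.continuous_exp.tendsto _).comp (this.const_mul (-(v * t ^ 2 / 2)))

theorem tendsto_abs_div_sqrt (t : ℝ) :
    Tendsto (fun n : ℕ ↦ |t / √(n + 1 : ℝ)|) atTop (nhds 0) := by
  have : Tendsto (fun n : ℕ ↦ √(n + 1 : ℝ)) atTop atTop :=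
    Real.tendsto_sqrt_atTop.comp (tendsto_atTop_add_const_right _ _ tendsto_natCast_atTop_atTop)
  simpa using (this.const_div_atTop t).abs

theorem tendsto_error (t : ℝ) :
    Tendsto (fun n : ℕ ↦ n * |t / √(n + 1 : ℝ)| ^ 3 + |t / √(n + 1 : ℝ)|) atTop (nhds 0) := by
  have h0 := tendsto_abs_div_sqrt t
  have hub : Tendsto (fun n : ℕ ↦ (t ^ 2 + 1) * |t / √(n + 1 : ℝ)|) atTop (nhds 0) := by
    simpa using h0.const_mul (t ^ 2 + 1)
  refine squeeze_zero (fun n ↦ by positivity) (fun n ↦ ?_) hub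
  have hn : (0 : ℝ) < n + 1 := by positivity
  have hsq : |t / √(n + 1 : ℝ)| ^ 2 = t ^ 2 / (n + 1) := by
    rw [sq_abs, div_pow, Real.sq_sqrt hn.le]
  have hle : n * |t / √(n + 1 : ℝ)| ^ 2 ≤ t ^ 2 := by
    rw [hsq, mul_div_assoc', div_le_iff₀ hn]
    nlinarith [sq_nonneg t]
  calc n * |t / √(n + 1 : ℝ)| ^ 3 + |t / √(n + 1 : ℝ)|
      = (n * |t / √(n + 1 : ℝ)| ^ 2) * |t / √(n + 1 : ℝ)| + |t / √(n + 1 : ℝ)| := by ring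
    _ ≤ t ^ 2 * |t / √(n + 1 : ℝ)| + |t / √(n + 1 : ℝ)| := by gcongr
    _ = _ := by ring

theorem sqrt_mul_sampleMean_sub {Ω : Type*} (X : ℕ → Ω → ℝ) (n : ℕ) (ω : Ω) (p : ℝ) :
    √(n + 1 : ℝ) * (sampleMean X n ω - p)
      = (∑ t ∈ Finset.range (n + 1), (X t ω - p)) / √(n + 1 : ℝ) := by
  have hn : (0 : ℝ) < n + 1 := by positivity
  have hs : √(n + 1 : ℝ) ≠ 0 := (Real.sqrt_pos.2 hn).ne'
  have hss : √(n + 1 : ℝ) ^ 2 = n + 1 := Real.sq_sqrt hn.le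
  rw [sampleMean, Finset.sum_sub_distrib, Finset.sum_const, Finset.card_range, nsmul_eq_mul,
    eq_div_iff hs]
  push_cast
  field_simp
  rw [hss]

theorem mainTheorem3 (a p : ℝ) (ha0 : 0 < a) (ha1 : a < 1) (hp0 : 0 < p) (hp1 : p < 1)
    {Ω : ℕ → Type*} [∀ n, MeasurableSpace (Ω n)]
    (P : (n : ℕ) → Measure (Ω n)) [∀ n, IsProbabilityMeasure (P n)]
    (X : (n : ℕ) → ℕ → Ω n → ℝ)
    (hX : ∀ n, IsCopulaMarkovChain (P n) (frechetCopula a)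
      (bernoulliMeasure (1 : ℝ) 0 ⟨p, hp0.le, hp1.le⟩) n (X n)) :
    TendstoInDistribution
      (fun (n : ℕ) (ω : Ω n) ↦ √(n + 1 : ℝ) * (sampleMean (X n) n ω - p))
      atTop (id : ℝ → ℝ) P (gaussianReal 0 (limitVariance a p).toNNReal) := by
  have hmeas : ∀ n : ℕ, Measurable fun ω ↦ √(n + 1 : ℝ) * (sampleMean (X n) n ω - p) := by
    intro n
    have : Measurable fun ω ↦ ∑ t ∈ Finset.range (n + 1), X n t ω :=
      Finset.measurable_sum _ fun t ht ↦
        (hX n).measurable t (Nat.lt_succ_iff.1 (Finset.mem_range.1 ht))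
    unfold sampleMean
    fun_prop
  refine ⟨fun n ↦ (hmeas n).aemeasurable, aemeasurable_id, ?_⟩
  refine ProbabilityMeasure.tendsto_iff_tendsto_charFun.2 fun t ↦ ?_
  obtain ⟨l, hl, hC, hv⟩ := exists_frechetCopula_eq ha0 ha1 hp0 hp1
  obtain ⟨c, hc⟩ := IsCharRecursion.exists_norm_sub_exp_le hp0 hp1 hl
  simp only [ProbabilityMeasure.coe_mk, Measure.map_id, charFun_gaussianReal,
    Real.coe_toNNReal _ (limitVariance_pos ha0 ha1 hp0 hp1).le]
  have hchar : ∀ n : ℕ,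
      charFun ((P n).map fun ω ↦ √(n + 1 : ℝ) * (sampleMean (X n) n ω - p)) t
        = ∫ ω, expSum p (t / √(n + 1 : ℝ)) (X n) (n + 1) ω ∂(P n) := by
    intro n
    rw [charFun_apply_real, integral_map (hmeas n).aemeasurable (by fun_prop)]
    refine integral_congr_ae (ae_of_all _ fun ω ↦ ?_)
    dsimp only
    rw [sqrt_mul_sampleMean_sub, expSum]
    congr 1
    push_cast
    ring
  simp_rw [hchar]
  have hlim := (Complex.continuous_ofReal.tendsto _).comp
    (tendsto_exp_neg_pow (limitVariance a p) t)
  have htarget : Complex.exp (t * (0 : ℝ) * Complex.I - limitVariance a p * t ^ 2 / 2)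
      = ((Real.exp (-(limitVariance a p * t ^ 2 / 2)) : ℝ) : ℂ) := by
    push_cast
    congr 1
    ring
  rw [htarget]
  refine tendsto_of_tendsto_of_dist hlim ?_
  have herr : Tendsto (fun n : ℕ ↦ c * (n * |t / √(n + 1 : ℝ)| ^ 3 + |t / √(n + 1 : ℝ)|))
      atTop (nhds 0) := by simpa using (tendsto_error t).const_mul c
  have hsmall : ∀ᶠ n : ℕ in atTop, |t / √(n + 1 : ℝ)| ≤ (1 - |l|) / 14 :=
    (tendsto_abs_div_sqrt t).eventually_le_const (by linarith)
  refine squeeze_zero' (Eventually.of_forall fun n ↦ dist_nonneg) ?_ herr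
  filter_upwards [hsmall] with n hn
  rw [dist_comm, dist_eq_norm]
  have := hc _ hn n _ _ ((hX n).isCharRecursion hp0 hp1 hC (t / √(n + 1 : ℝ)))
  rw [hv]
  exact this
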